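/- Let $\beta>1$ be a real number. Put $T_{-\beta}(x)=-\beta x-\big\lfloor-\beta x+\frac{\beta}{\beta+1}\big\rfloor$, and for $y\in\big[\frac{-\beta}{\beta+1},\frac1{\beta+1}\big)$ put $d_{-\beta}(y)=y_1y_2y_3\cdots$ with $y_k=\big\lfloor-\beta\,T_{-\beta}^{k-1}(y)+\frac{\beta}{\beta+1}\big\rfloor$. For $x\in\mathbb R$ let $j\ge 0$ be the minimal non-negative integer such that $y=x(-\beta)^{-j}\in\big(\frac{-\beta}{\beta+1},\frac1{\beta+1}\big)$; the $(-\beta)$-expansion of $x$ is $\langle x\rangle_{-\beta}=y_1\cdots y_j\bullet y_{j+1}y_{j+2}\cdots$ (and $0\bullet y_1y_2\cdots$ if $j=0$), where $y_1y_2y_3\cdots=d_{-\beta}(y)$, so that the digit $y_k$ is the coefficient of $(-\beta)^{j-k}$. Let $\mathrm{Fin}(-\beta)$ be the set of real numbers whose $(-\beta)$-expansion has only finitely many non-zero digits, and let $\mathbb Z_{-\beta}$ be the set of real numbers whose $(-\beta)$-expansion has no non-zero digit to the right of $\bullet$. Define $$L_\oplus(-\beta)=\min\{l\in\mathbb N\mid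 \forall x,y\in\mathbb Z_{-\beta},\ x+y\in\mathrm{Fin}(-\beta)\Rightarrow x+y\in(-\beta)^{-l}\mathbb Z_{-\beta}\},$$ $$L_\otimes(-\beta)=\min\{l\in\mathbb N\mid \forall x,y\in\mathbb Z_{-\beta},\ xy\in\mathrm{Fin}(-\beta)\Rightarrow xy\in(-\beta)^{-l}\mathbb Z_{-\beta}\},$$ where $\mathbb N$ contains $0$. **Theorem.** Let $\beta>1$ satisfy $\beta^2=m\beta-1$ for some $m\in\mathbb N$ with $m\ge 3$. Then both minima exist and $$L_\oplus(-\beta)=2=L_\otimes(-\beta).$$ -/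

import Mathlib

namespace NegBeta

noncomputable section

/-- The Ito-Sadahiro transformation `T(x) = -βx - ⌊-βx + β/(β+1)⌋`. It maps the interval
`[-β/(β+1), 1/(β+1))` into itself. -/
def T (β x : ℝ) : ℝ := -β * x - (⌊-β * x + β / (β + 1)⌋ : ℤ)

/-- The `k`-th digit (for `k ≥ 1`) of the digit string `d(y) = y₁ y₂ y₃ ⋯`
of `y ∈ [-β/(β+1), 1/(β+1))`. -/
def fracDigit (β y : ℝ) (k : ℕ) : ℤ := ⌊-β * (T β)^[k - 1] y + β / (β + 1)⌋

/-- The minimal non-negative integer `j` such that `x (-β)^(-j)` lies in the open interval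
`(-β/(β+1), 1/(β+1))`. Such a `j` exists for every real `x` when `β > 1`. -/
def shift (β x : ℝ) : ℕ :=
  sInf {j : ℕ | x * (-β) ^ (-(j : ℤ)) ∈ Set.Ioo (-β / (β + 1)) (1 / (β + 1))}

/-- The `(-β)`-expansion of `x`: `digit β x i` is the coefficient of `(-β)^i`. With `j = shift β x`
and `y = x (-β)^(-j)`, the expansion is `y₁ ⋯ y_j • y_{j+1} y_{j+2} ⋯`, so that `y_k` stands at
position `j - k`; the digits at positions `≥ j` are zero. -/
def digit (β x : ℝ) (i : ℤ) : ℤ :=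
  if i < (shift β x : ℤ) then
    fracDigit β (x * (-β) ^ (-(shift β x : ℤ))) ((shift β x : ℤ) - i).toNat
  else 0

/-- `Fin(-β)`: the reals whose `(-β)`-expansion has only finitely many non-zero digits. -/
def finSet (β : ℝ) : Set ℝ := {x | {i : ℤ | digit β x i ≠ 0}.Finite}

/-- `ℤ_{-β}`, the `(-β)`-integers: the reals whose `(-β)`-expansion has no non-zero digit at
a negative position. -/
def integers (β : ℝ) : Set ℝ := {x | ∀ i : ℤ, i < 0 → digit β x i = 0}

/-- The set `(-β)^(-l) ℤ_{-β}`. -/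
def scaledIntegers (β : ℝ) (l : ℕ) : Set ℝ :=
  (fun z : ℝ => (-β) ^ (-(l : ℤ)) * z) '' integers β

/-- The set of `l ∈ ℕ` whose minimum is `L_⊕(-β)`. -/
def addBounds (β : ℝ) : Set ℕ :=
  {l | ∀ x ∈ integers β, ∀ y ∈ integers β, x + y ∈ finSet β → x + y ∈ scaledIntegers β l}

/-- The set of `l ∈ ℕ` whose minimum is `L_⊗(-β)`. -/
def mulBounds (β : ℝ) : Set ℕ :=
  {l | ∀ x ∈ integers β, ∀ y ∈ integers β, x * y ∈ finSet β → x * y ∈ scaledIntegers β l}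

/-- `L_⊕(-β) = L`: the minimum defining `L_⊕(-β)` exists and equals `L`. -/
def IsLAdd (β : ℝ) (L : ℕ) : Prop := IsLeast (addBounds β) L

/-- `L_⊗(-β) = L`: the minimum defining `L_⊗(-β)` exists and equals `L`. -/
def IsLMul (β : ℝ) (L : ℕ) : Prop := IsLeast (mulBounds β) L

end

end NegBeta

namespace NegBeta

variable {β : ℝ}

/-! Since `β` is a quadratic unit of norm 1, its conjugate is `β⁻¹`, so conjugation in `ℤ[β]` turns
an expansion in powers of `-β` into one in powers of `-β⁻¹`, where digits far left of the point
hardly count. The conjugates of `(-β)`-integers therefore lie in a bounded window; if the last digit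
is non-zero, the conjugate exceeds `(β-1)/(β(β+1))` (`step_inWindow`).

Upper bound: let `x` have conjugate `c` and exactly `r ≥ 3` fractional digits. Then `(-β)^r x` is an
integer with non-zero last digit and conjugate `(-β⁻¹)^r c`, so `c` must be large, with the sign of
`(-1)^r`. Sums and products of integers have conjugates too small for this
(`mem_scaledIntegers_two`).

Lower bound: `(m-2) + 1` and `(β²+m-2)(β²+1)` have explicit expansions with exactly two fractional
digits. Admissibility is checked digit by digit from the right (`cons_spec`): the digit `m-1` may
only precede a remainder below `-1/(β(β+1))`, so in particular not a 0. -/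

/-- The open interval `(-β/(β+1), 1/(β+1))`. -/
def domain (β : ℝ) : Set ℝ := Set.Ioo (-β / (β + 1)) (1 / (β + 1))

/-! ### Dynamics of `T` and vanishing remainders -/

theorem mem_domain_iff (hβ : 1 < β) {z : ℝ} :
    z ∈ domain β ↔ -β < z * (β + 1) ∧ z * (β + 1) < 1 := by
  have h : 0 < β + 1 := by linarith
  rw [domain, Set.mem_Ioo, div_lt_iff₀ h, lt_div_iff₀ h]

theorem zero_mem_domain (hβ : 1 < β) : (0 : ℝ) ∈ domain β := by
  rw [mem_domain_iff hβ]
  constructor <;> linarith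

/-- The half-open interval `[-β/(β+1), 1/(β+1))`, cleared of denominators, is invariant. -/
theorem T_bounds (hβ : 1 < β) (z : ℝ) :
    -β ≤ T β z * (β + 1) ∧ T β z * (β + 1) < 1 := by
  have h : 0 < β + 1 := by linarith
  have h1 := Int.floor_le (-β * z + β / (β + 1))
  have h2 := Int.lt_floor_add_one (-β * z + β / (β + 1))
  have h3 : β / (β + 1) * (β + 1) = β := by field_simp
  unfold T
  constructor <;> nlinarith

theorem iterate_T_bounds (hβ : 1 < β) {y : ℝ} (hy : y ∈ domain β) (n : ℕ) :
    -β ≤ (T β)^[n] y * (β + 1) ∧ (T β)^[n] y * (β + 1) < 1 := by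
  cases n with
  | zero =>
    have := (mem_domain_iff hβ).1 hy
    exact ⟨this.1.le, this.2⟩
  | succ n =>
    rw [Function.iterate_succ_apply']
    exact T_bounds hβ _

theorem T_eq_of_bounds (hβ : 1 < β) {z w : ℝ} (d : ℤ) (h : -β * z = d + w)
    (h1 : -β ≤ w * (β + 1)) (h2 : w * (β + 1) < 1) : T β z = w := by
  have hp : 0 < β + 1 := by linarith
  have h3 : β / (β + 1) * (β + 1) = β := by field_simp
  have hf : ⌊-β * z + β / (β + 1)⌋ = d := by
    rw [Int.floor_eq_iff]
    constructor <;> nlinarith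
  rw [T, hf, h]
  ring

theorem T_zero (hβ : 1 < β) : T β 0 = 0 :=
  T_eq_of_bounds hβ 0 (by simp) (by linarith) (by linarith)

theorem iterate_T_eq_zero_of_le (hβ : 1 < β) {y : ℝ} {n k : ℕ} (hnk : n ≤ k)
    (h : (T β)^[n] y = 0) : (T β)^[k] y = 0 := by
  obtain ⟨j, rfl⟩ := Nat.exists_eq_add_of_le' hnk
  rw [Function.iterate_add_apply, h]
  exact Function.iterate_fixed (T_zero hβ) j

theorem T_iterate_succ_eq (y : ℝ) (n : ℕ) :
    (T β)^[n + 1] y = -β * (T β)^[n] y - fracDigit β y (n + 1) := by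
  rw [Function.iterate_succ_apply']
  rfl

theorem fracDigit_eq_zero_of_iterate (hβ : 1 < β) {y : ℝ} {n : ℕ}
    (h : (T β)^[n] y = 0) : fracDigit β y (n + 1) = 0 := by
  have h0 := T_iterate_succ_eq (β := β) y n
  rw [iterate_T_eq_zero_of_le hβ (Nat.le_succ n) h, h] at h0
  exact_mod_cast (by linarith : (fracDigit β y (n + 1) : ℝ) = 0)

/-- While the digits vanish, each step multiplies the remainder by `-β`; a non-zero remainder would
leave the bounded interval. -/
theorem iterate_T_eq_zero_of_digits (hβ : 1 < β) {y : ℝ} (hy : y ∈ domain β) {n : ℕ}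
    (h : ∀ k, n ≤ k → fracDigit β y (k + 1) = 0) : (T β)^[n] y = 0 := by
  have hpow : ∀ k, (T β)^[n + k] y = (-β) ^ k * (T β)^[n] y := by
    intro k
    induction k with
    | zero => simp
    | succ k ih =>
      rw [← add_assoc, T_iterate_succ_eq, h _ (Nat.le_add_right n k), ih, pow_succ]
      push_cast
      ring
  by_contra hz
  have hpos : 0 < |(T β)^[n] y| := abs_pos.2 hz
  obtain ⟨k, hk⟩ := pow_unbounded_of_one_lt (1 / |(T β)^[n] y|) hβ
  rw [div_lt_iff₀ hpos] at hk
  have hb := iterate_T_bounds hβ hy (n + k)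
  have habs : |(T β)^[n + k] y| ≤ 1 := by
    rw [abs_le]
    constructor <;> nlinarith
  rw [hpow, abs_mul, abs_pow, abs_neg, abs_of_pos (by linarith : 0 < β)] at habs
  linarith

/-! ### Independence of the digits from the chosen shift -/

/-- The open left end is essential: `u = -β/(β+1)` would give `y = 1/(β+1)`, outside the interval.
-/
theorem neg_div_mem_domain (hβ : 1 < β) {u y : ℝ} (hu : u ∈ domain β) (h : -β * y = u) :
    y ∈ domain β := by
  rw [mem_domain_iff hβ] at *
  subst h
  constructor <;> nlinarith

theorem T_eq_of_mem_domain (hβ : 1 < β) {u y : ℝ} (hu : u ∈ domain β) (h : -β * y = u) :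
    T β y = u := by
  have := (mem_domain_iff hβ).1 hu
  exact T_eq_of_bounds hβ 0 (by simpa using h) this.1.le this.2

/-- The digit at position `i` read off the expansion of `y` shifted by `n` places. -/
noncomputable def shiftedDigit (β : ℝ) (n : ℕ) (y : ℝ) (i : ℤ) : ℤ :=
  if i < (n : ℤ) then fracDigit β y ((n : ℤ) - i).toNat else 0

/-- Shifting one place further than necessary only prepends a digit 0, because `-βy` already lies in
the interval. -/
theorem shiftedDigit_succ (hβ : 1 < β) {u y : ℝ} (hu : u ∈ domain β) (h : -β * y = u)
    (n : ℕ) (i : ℤ) : shiftedDigit β (n + 1) y i = shiftedDigit β n u i := by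
  have hT := T_eq_of_mem_domain hβ hu h
  unfold shiftedDigit
  rcases lt_trichotomy i n with hi | rfl | hi
  · obtain ⟨k, hk⟩ : ∃ k : ℕ, (n : ℤ) - i = k + 1 := ⟨((n : ℤ) - i - 1).toNat, by omega⟩
    have e1 : (((n + 1 : ℕ) : ℤ) - i).toNat = k + 2 := by omega
    have e2 : ((n : ℤ) - i).toNat = k + 1 := by omega
    rw [if_pos hi, if_pos (by omega), e1, e2]
    simp only [fracDigit, Nat.add_sub_cancel, show k + 2 - 1 = k + 1 by omega,
      Function.iterate_succ_apply, hT]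
  · have e1 : (((n + 1 : ℕ) : ℤ) - n).toNat = 0 + 1 := by omega
    rw [if_neg (lt_irrefl _), if_pos (by omega), e1]
    have h0 := T_iterate_succ_eq (β := β) y 0
    simp only [zero_add, Function.iterate_one, Function.iterate_zero, id_eq, hT, h] at h0
    exact_mod_cast (by linarith : (fracDigit β y 1 : ℝ) = 0)
  · rw [if_neg (by omega), if_neg (by omega)]

theorem shiftedDigit_add (hβ : 1 < β) (j k : ℕ) {u y : ℝ} (hu : u ∈ domain β)
    (h : (-β) ^ k * y = u) (i : ℤ) : shiftedDigit β (j + k) y i = shiftedDigit β j u i := by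
  induction k generalizing u j with
  | zero =>
    simp only [pow_zero, one_mul] at h
    rw [h, add_zero]
  | succ k ih =>
    have h' : -β * ((-β) ^ k * y) = u := by rw [← h, pow_succ]; ring
    rw [← shiftedDigit_succ hβ hu h' j i, ← ih (j + 1) (neg_div_mem_domain hβ hu h') rfl,
      show j + (k + 1) = j + 1 + k by omega]

theorem digit_eq_shiftedDigit (hβ : 1 < β) (n : ℕ) {y : ℝ} (hy : y ∈ domain β) (i : ℤ) :
    digit β ((-β) ^ n * y) i = shiftedDigit β n y i := by
  have h0 : (-β) ≠ 0 := by linarith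
  set x := (-β) ^ n * y with hx
  have hn : n ∈ {j : ℕ | x * (-β) ^ (-(j : ℤ)) ∈ Set.Ioo (-β / (β + 1)) (1 / (β + 1))} := by
    have : x * (-β) ^ (-(n : ℤ)) = y := by
      rw [hx, zpow_neg, zpow_natCast]
      field_simp
    rw [Set.mem_ofPred_eq, this]
    exact hy
  have hmem := Nat.sInf_mem ⟨n, hn⟩
  obtain ⟨k, hk⟩ := Nat.exists_eq_add_of_le (Nat.sInf_le hn)
  change n = shift β x + k at hk
  have hu : x * (-β) ^ (-(shift β x : ℤ)) ∈ domain β := hmem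
  rw [hk, shiftedDigit_add hβ (shift β x) k hu _ i]
  · rfl
  · have : x = (-β) ^ shift β x * ((-β) ^ k * y) := by
      rw [← mul_assoc, ← pow_add, ← hk]
    rw [zpow_neg, zpow_natCast]
    field_simp
    rw [mul_comm, ← mul_assoc, ← pow_add, ← hk]

/-! ### The three sets in terms of vanishing iterates of `T` -/

theorem exists_eq_pow_mul (hβ : 1 < β) (x : ℝ) : ∃ n : ℕ, ∃ y ∈ domain β, x = (-β) ^ n * y := by
  obtain ⟨n, hn⟩ := pow_unbounded_of_one_lt (|x| * (β + 1)) hβ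
  have h0 : (-β) ≠ 0 := by linarith
  refine ⟨n, x / (-β) ^ n, ?_, by field_simp⟩
  have hp : 0 < β ^ n := by positivity
  have hlt : |x / (-β) ^ n| * (β + 1) < 1 := by
    rw [abs_div, abs_pow, abs_neg, abs_of_pos (by linarith : 0 < β), div_mul_eq_mul_div,
      div_lt_one hp]
    exact hn
  rw [mem_domain_iff hβ]
  have h1 := neg_abs_le (x / (-β) ^ n)
  have h2 := le_abs_self (x / (-β) ^ n)
  constructor <;> nlinarith

theorem pow_mul_mem_integers_iff (hβ : 1 < β) (n : ℕ) {y : ℝ} (hy : y ∈ domain β) :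
    (-β) ^ n * y ∈ integers β ↔ (T β)^[n] y = 0 := by
  simp only [integers, Set.mem_ofPred_eq, digit_eq_shiftedDigit hβ n hy]
  constructor
  · refine fun h => iterate_T_eq_zero_of_digits hβ hy fun k hk => ?_
    have := h ((n : ℤ) - (k + 1)) (by omega)
    rw [shiftedDigit, if_pos (by omega)] at this
    rwa [show ((n : ℤ) - (n - (k + 1))).toNat = k + 1 by omega] at this
  · intro h i hi
    rw [shiftedDigit, if_pos (by omega)]
    obtain ⟨k, hk⟩ : ∃ k : ℕ, (n : ℤ) - i = n + k + 1 := ⟨(-i - 1).toNat, by omega⟩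
    rw [show ((n : ℤ) - i).toNat = n + k + 1 by omega]
    exact fracDigit_eq_zero_of_iterate hβ (iterate_T_eq_zero_of_le hβ (Nat.le_add_right n k) h)

theorem pow_mul_mem_scaledIntegers_iff (hβ : 1 < β) (n l : ℕ) {y : ℝ} (hy : y ∈ domain β) :
    (-β) ^ n * y ∈ scaledIntegers β l ↔ (T β)^[n + l] y = 0 := by
  have h0 : (-β) ≠ 0 := by linarith
  rw [← pow_mul_mem_integers_iff hβ _ hy, scaledIntegers, Set.mem_image]
  simp only [zpow_neg, zpow_natCast]
  constructor
  · rintro ⟨z, hz, h⟩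
    have : (-β) ^ (n + l) * y = z := by
      rw [add_comm, pow_add, mul_assoc, ← h]
      field_simp
    rwa [this]
  · intro h
    refine ⟨_, h, ?_⟩
    rw [add_comm, pow_add]
    field_simp

theorem pow_mul_mem_finSet_iff (hβ : 1 < β) (n : ℕ) {y : ℝ} (hy : y ∈ domain β) :
    (-β) ^ n * y ∈ finSet β ↔ ∃ N, (T β)^[N] y = 0 := by
  simp only [finSet, Set.mem_ofPred_eq, digit_eq_shiftedDigit hβ n hy]
  constructor
  · intro h
    obtain ⟨b, hb⟩ := h.bddBelow
    refine ⟨(n - b).toNat, iterate_T_eq_zero_of_digits hβ hy fun k hk => ?_⟩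
    by_contra hne
    have hmem : (n : ℤ) - (k + 1) ∈ {i : ℤ | shiftedDigit β n y i ≠ 0} := by
      rw [Set.mem_ofPred_eq, shiftedDigit, if_pos (by omega),
        show ((n : ℤ) - (n - (k + 1))).toNat = k + 1 by omega]
      exact hne
    have := hb hmem
    omega
  · rintro ⟨N, hN⟩
    refine (Set.finite_Ico ((n : ℤ) - N) n).subset fun i hi => ?_
    rw [Set.mem_ofPred_eq, shiftedDigit] at hi
    split_ifs at hi with h
    · refine ⟨?_, h⟩
      by_contra hlt
      refine hi ?_
      obtain ⟨k, hk⟩ : ∃ k : ℕ, (n : ℤ) - i = N + k + 1 := ⟨(n - i - N - 1).toNat, by omega⟩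
      rw [show ((n : ℤ) - i).toNat = N + k + 1 by omega]
      exact fracDigit_eq_zero_of_iterate hβ
        (iterate_T_eq_zero_of_le hβ (Nat.le_add_right N k) hN)
    · exact absurd rfl hi

/-! ### Conjugation in `ℤ[β]` -/

/-- `x = p + qβ` and `c = p + qβ⁻¹` for some integers `p`, `q`. For a quadratic unit `β` of norm
`1` this says that `c` is the Galois conjugate of `x ∈ ℤ[β]`. -/
def IsConj (β x c : ℝ) : Prop := ∃ p q : ℤ, x = p + q * β ∧ c = p + q * β⁻¹

theorem IsConj.intCast (p : ℤ) : IsConj β p p := ⟨p, 0, by simp, by simp⟩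

theorem IsConj.add {x y c d : ℝ} (hx : IsConj β x c) (hy : IsConj β y d) :
    IsConj β (x + y) (c + d) := by
  obtain ⟨p, q, rfl, rfl⟩ := hx
  obtain ⟨p', q', rfl, rfl⟩ := hy
  exact ⟨p + p', q + q', by push_cast; ring, by push_cast; ring⟩

variable {m : ℕ}

theorem inv_eq (hroot : β ^ 2 = (m : ℝ) * β - 1) : β⁻¹ = m - β := by
  refine inv_eq_of_mul_eq_one_right ?_
  linear_combination -hroot

theorem IsConj.mul (hroot : β ^ 2 = (m : ℝ) * β - 1) {x y c d : ℝ}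
    (hx : IsConj β x c) (hy : IsConj β y d) : IsConj β (x * y) (c * d) := by
  obtain ⟨p, q, rfl, rfl⟩ := hx
  obtain ⟨p', q', rfl, rfl⟩ := hy
  refine ⟨p * p' - q * q', p * q' + p' * q + m * q * q', ?_, ?_⟩
  · push_cast
    linear_combination (q : ℝ) * q' * hroot
  · rw [inv_eq hroot]
    push_cast
    linear_combination (q : ℝ) * q' * hroot

theorem IsConj.neg_base : IsConj β (-β) (-β⁻¹) := ⟨0, -1, by simp, by simp⟩

theorem IsConj.pow_mul (hroot : β ^ 2 = (m : ℝ) * β - 1) {x c : ℝ}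
    (hx : IsConj β x c) (k : ℕ) : IsConj β ((-β) ^ k * x) ((-β⁻¹) ^ k * c) := by
  induction k with
  | zero => simpa using hx
  | succ k ih =>
    rw [pow_succ', pow_succ', mul_assoc, mul_assoc]
    exact IsConj.mul hroot IsConj.neg_base ih

/-- For `m ≥ 3` the discriminant `m² - 4` lies strictly between `(m-1)²` and `m²`, hence is not a
square. -/
theorem irrational_of_root (hm : 3 ≤ m) (hroot : β ^ 2 = (m : ℝ) * β - 1) : Irrational β := by
  have h2 : (2 * β - m) ^ 2 = (((m : ℤ) ^ 2 - 4 : ℤ) : ℝ) := by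
    push_cast
    linear_combination 4 * hroot
  have hirr : Irrational (2 * β - m) := by
    refine irrational_nrt_of_notint_nrt 2 _ h2 ?_ (by norm_num)
    rintro ⟨y, hy⟩
    rw [hy] at h2
    have h3 : y ^ 2 = (m : ℤ) ^ 2 - 4 := by exact_mod_cast h2
    have hm' : (3 : ℤ) ≤ m := by exact_mod_cast hm
    rcases abs_cases y with ⟨ha, _⟩ | ⟨ha, _⟩ <;> rw [← sq_abs] at h3 <;>
      generalize |y| = z at * <;>
      · have h4 : z < m := by nlinarith
        have h5 : (m : ℤ) - 1 < z := by nlinarith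
        omega
  rintro ⟨r, rfl⟩
  exact hirr ⟨2 * r - m, by push_cast; rfl⟩

theorem IsConj.unique (hirr : Irrational β) {x c d : ℝ}
    (hc : IsConj β x c) (hd : IsConj β x d) : c = d := by
  obtain ⟨p, q, rfl, rfl⟩ := hc
  obtain ⟨p', q', h, rfl⟩ := hd
  by_cases hq : q = q'
  · subst hq
    simpa using h
  · have hq' : ((q : ℝ) - q') ≠ 0 := by
      rw [sub_ne_zero]
      exact_mod_cast hq
    refine absurd ⟨(p' - p) / (q - q'), ?_⟩ hirr
    push_cast
    rw [div_eq_iff hq']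
    linarith

/-! ### The window of the conjugates -/

/-- The bounds satisfied by the conjugate `c` of the integer part of an expansion whose
fractional part is `z`. -/
structure InWindow (β z c : ℝ) : Prop where
  lower : -(β - 1) < c * (β + 1)
  upper : c * (β + 1) < β ^ 2 + 1
  upper_of_lt : -1 < z * (β * (β + 1)) → c * (β + 1) < β * (β - 1)

/-- Appending a digit `d` sends the conjugate `c` to `d - β⁻¹c`. The window is stable only because
it remembers the remainder: a digit 0 forces `z > -1/(β(β+1))`, which gives the sharper upper bound
on `c`, while a digit `m-1` leaves a remainder at most `-1/(β(β+1))`, for which only the weaker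
bound is claimed. -/
theorem step_inWindow (hβ : 1 < β) (hroot : β ^ 2 = (m : ℝ) * β - 1) {z c : ℝ} {d : ℤ}
    (hz : -β ≤ z * (β + 1)) (hz' : z * (β + 1) < 1) (hw : InWindow β z c)
    (hd : T β z = -β * z - d) :
    InWindow β (T β z) (d - β⁻¹ * c) ∧
      (d ≠ 0 → β - 1 < (d - β⁻¹ * c) * (β * (β + 1))) := by
  obtain ⟨h1, h2, h3⟩ := hw
  obtain ⟨t1, t2⟩ := T_bounds hβ z
  have hb : β * β⁻¹ = 1 := mul_inv_cancel₀ (by linarith)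
  have hp : 0 < β + 1 := by linarith
  have hpp : 0 < β * (β + 1) := by positivity
  have hb0 : 0 < β⁻¹ := by positivity
  have hb1 : β⁻¹ < 1 := inv_lt_one_of_one_lt₀ hβ
  have hdT : (d : ℝ) * (β + 1) = -β * (z * (β + 1)) - T β z * (β + 1) := by rw [hd]; ring
  generalize T β z = t at *
  have hd0 : 0 ≤ d := by
    have : (-1 : ℝ) < d := by nlinarith
    have : (-1 : ℤ) < d := by exact_mod_cast this
    omega
  have hdm : d ≤ m - 1 := by
    have h4 : (d : ℝ) ≤ β := by nlinarith
    have h5 : β < m := by nlinarith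
    have : d < (m : ℤ) := by exact_mod_cast h4.trans_lt h5
    omega
  rcases hd0.eq_or_lt with h0 | h0
  · subst h0
    have hc := h3 (by push_cast at hdT; nlinarith)
    have e : ((0 : ℤ) - β⁻¹ * c) * (β + 1) = -(β⁻¹ * (c * (β + 1))) := by push_cast; ring
    have l1 : β⁻¹ * (c * (β + 1)) < β - 1 := by
      calc _ < β⁻¹ * (β * (β - 1)) := mul_lt_mul_of_pos_left hc hb0
        _ = β - 1 := by field_simp
    have l2 : -(β⁻¹ * (c * (β + 1))) < β - 1 := by nlinarith
    refine ⟨⟨?_, ?_, fun _ => ?_⟩, fun h => absurd rfl h⟩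
    · push_cast at e ⊢; linarith
    · push_cast at e ⊢; nlinarith
    · push_cast at e ⊢; nlinarith
  · have hd1 : (1 : ℝ) ≤ d := by exact_mod_cast h0
    have e : (d - β⁻¹ * c) * (β * (β + 1)) = d * (β * (β + 1)) - c * (β + 1) := by
      linear_combination -c * (β + 1) * hb
    have e' : (d - β⁻¹ * c) * (β * (β + 1)) = β * ((d - β⁻¹ * c) * (β + 1)) := by ring
    have lo : β - 1 < (d - β⁻¹ * c) * (β * (β + 1)) := by
      rw [e]
      nlinarith
    have hdm' : (d : ℝ) ≤ m - 1 := by exact_mod_cast hdm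
    have em : ((m : ℝ) - 1) * (β * (β + 1)) = β ^ 3 + 1 := by
      linear_combination -(β + 1) * hroot
    refine ⟨⟨?_, ?_, fun ht => ?_⟩, fun _ => lo⟩
    · by_contra hcon
      nlinarith
    · have := mul_le_mul_of_nonneg_right hdm' hpp.le
      refine lt_of_mul_lt_mul_left ?_ (by linarith : 0 ≤ β)
      rw [← e', e]
      nlinarith
    -- With `z ≥ -β/(β+1)`, the digit `m-1` would leave a remainder at most `β²/(β+1) - (m-1) =
    -- -1/(β(β+1))`, against `ht`.
    · have hne : d ≠ m - 1 := by
        rintro rfl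
        push_cast at hd
        nlinarith
      have hd2 : (d : ℝ) ≤ m - 1 - 1 := by
        have : d ≤ (m : ℤ) - 1 - 1 := by omega
        exact_mod_cast this
      have := mul_le_mul_of_nonneg_right hd2 hpp.le
      refine lt_of_mul_lt_mul_left ?_ (by linarith : 0 ≤ β)
      rw [← e', e]
      nlinarith

theorem InWindow.zero_zero (hβ : 1 < β) (z : ℝ) : InWindow β z 0 :=
  ⟨by linarith, by nlinarith, fun _ => by nlinarith⟩

/-- `(-β)^n y - T^n y` is the value of the first `n` digits read as an integer part, so it obeys the
Horner recursion `v ↦ -βv + d`. -/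
theorem exists_inWindow (hβ : 1 < β) (hroot : β ^ 2 = (m : ℝ) * β - 1) {y : ℝ}
    (hy : y ∈ domain β) (n : ℕ) :
    ∃ c, IsConj β ((-β) ^ n * y - (T β)^[n] y) c ∧ InWindow β ((T β)^[n] y) c := by
  induction n with
  | zero => exact ⟨0, ⟨0, 0, by simp, by simp⟩, InWindow.zero_zero hβ _⟩
  | succ n ih =>
    obtain ⟨c, hc, hw⟩ := ih
    obtain ⟨hz, hz'⟩ := iterate_T_bounds hβ hy n
    have hd := T_iterate_succ_eq (β := β) y n
    have hs := (step_inWindow hβ hroot hz hz' hw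
      (by rwa [Function.iterate_succ_apply'] at hd)).1
    rw [← Function.iterate_succ_apply' (T β)] at hs
    refine ⟨_, ?_, hs⟩
    have hconj := (IsConj.intCast (β := β) (fracDigit β y (n + 1))).add
      (IsConj.mul hroot IsConj.neg_base hc)
    convert hconj using 1
    · rw [hd]; ring
    · ring

/-- The conjugate of a finite expansion whose last digit is non-zero is bounded away from `0`. -/
theorem exists_isConj_of_last_digit_ne_zero (hβ : 1 < β) (hroot : β ^ 2 = (m : ℝ) * β - 1) {y : ℝ}
    (hy : y ∈ domain β) {n : ℕ} (hn : (T β)^[n] y ≠ 0) (hn' : (T β)^[n + 1] y = 0) :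
    ∃ c, IsConj β ((-β) ^ (n + 1) * y) c ∧ β - 1 < c * (β * (β + 1)) := by
  obtain ⟨c, hc, hw⟩ := exists_inWindow hβ hroot hy n
  obtain ⟨hz, hz'⟩ := iterate_T_bounds hβ hy n
  have hd := T_iterate_succ_eq (β := β) y n
  have hne : fracDigit β y (n + 1) ≠ 0 := by
    intro h0
    rw [hn', h0] at hd
    have : β * (T β)^[n] y = 0 := by push_cast at hd; linarith
    rcases mul_eq_zero.1 this with h | h
    · linarith
    · exact hn h
  have hs := (step_inWindow hβ hroot hz hz' hw
    (by rwa [Function.iterate_succ_apply'] at hd)).2 hne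
  refine ⟨_, ?_, hs⟩
  have hconj := (IsConj.intCast (β := β) (fracDigit β y (n + 1))).add
    (IsConj.mul hroot IsConj.neg_base hc)
  convert hconj using 1
  · rw [hn'] at hd
    linear_combination -hd
  · ring

theorem exists_isConj_of_mem_integers (hβ : 1 < β) (hroot : β ^ 2 = (m : ℝ) * β - 1) {x : ℝ}
    (hx : x ∈ integers β) :
    ∃ c, IsConj β x c ∧ -(β - 1) < c * (β + 1) ∧ c * (β + 1) < β * (β - 1) := by
  obtain ⟨n, y, hy, rfl⟩ := exists_eq_pow_mul hβ x
  rw [pow_mul_mem_integers_iff hβ n hy] at hx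
  obtain ⟨c, hc, hw⟩ := exists_inWindow hβ hroot hy n
  rw [hx] at hc hw
  exact ⟨c, by simpa using hc, hw.lower, hw.upper_of_lt (by simp)⟩

/-! ### At most two fractional digits -/

theorem mem_scaledIntegers_two (hβ : 1 < β) (hroot : β ^ 2 = (m : ℝ) * β - 1)
    (hirr : Irrational β) {x c : ℝ} (hx : x ∈ finSet β) (hc : IsConj β x c)
    (h1 : -(β ^ 2 * (β - 1)) ≤ c * (β + 1)) (h2 : c * (β + 1) ≤ β ^ 3 * (β - 1)) :
    x ∈ scaledIntegers β 2 := by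
  obtain ⟨n, y, hy, rfl⟩ := exists_eq_pow_mul hβ x
  rw [pow_mul_mem_finSet_iff hβ n hy] at hx
  rw [pow_mul_mem_scaledIntegers_iff hβ n 2 hy]
  by_contra hne
  classical
  have hN := Nat.find_spec hx
  have hlt : n + 2 < Nat.find hx := by
    by_contra hle
    exact hne (iterate_T_eq_zero_of_le hβ (not_lt.1 hle) hN)
  obtain ⟨k, hk⟩ := Nat.exists_eq_add_of_lt hlt
  have hpred : (T β)^[n + 2 + k] y ≠ 0 := Nat.find_min hx (by omega)
  rw [hk] at hN
  obtain ⟨c', hc', hlow⟩ := exists_isConj_of_last_digit_ne_zero hβ hroot hy hpred hN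
  have hcc := hc.pow_mul hroot (k + 3)
  rw [← mul_assoc, ← pow_add, show k + 3 + n = n + 2 + k + 1 by omega] at hcc
  rw [hc'.unique hirr hcc] at hlow
  have hβ0 : 0 < β := by linarith
  have hlow' : β ^ (k + 2) * (β - 1) < (-1) ^ (k + 3) * (c * (β + 1)) := by
    have e : (-β⁻¹) ^ (k + 3) * c * (β * (β + 1)) * β ^ (k + 2)
        = (-1) ^ (k + 3) * (c * (β + 1)) := by
      rw [← neg_one_mul β⁻¹, mul_pow, inv_pow]
      field_simp
      ring
    have := mul_lt_mul_of_pos_right hlow (by positivity : 0 < β ^ (k + 2))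
    linarith
  -- The sign of `c` is that of `(-1)^(k+3)`. An even `k` violates `h1`; an odd `k` is at least 1,
  -- which gains the extra factor `β` needed against `h2`.
  rcases Nat.even_or_odd k with hev | hod
  · rw [(show Odd (k + 3) from hev.add_odd (by decide)).neg_one_pow] at hlow'
    have : β ^ 2 ≤ β ^ (k + 2) := pow_le_pow_right₀ hβ.le (by omega)
    nlinarith
  · rw [(show Even (k + 3) from hod.add_odd (by decide)).neg_one_pow] at hlow'
    have : β ^ 3 ≤ β ^ (k + 2) := pow_le_pow_right₀ hβ.le (by have := hod.pos; omega)
    nlinarith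

theorem two_lt_of_root (hm : 3 ≤ m) (hβ : 1 < β) (hroot : β ^ 2 = (m : ℝ) * β - 1) : 2 < β := by
  have : (3 : ℝ) ≤ m := by exact_mod_cast hm
  nlinarith

theorem two_mem_addBounds (hm : 3 ≤ m) (hβ : 1 < β) (hroot : β ^ 2 = (m : ℝ) * β - 1) :
    2 ∈ addBounds β := by
  intro x hx y hy hxy
  obtain ⟨c, hc, c1, c2⟩ := exists_isConj_of_mem_integers hβ hroot hx
  obtain ⟨d, hd, d1, d2⟩ := exists_isConj_of_mem_integers hβ hroot hy
  have h2 := two_lt_of_root hm hβ hroot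
  -- Adding doubles the window, and a factor `β²` absorbs the 2 on both sides.
  have h4 : 2 ≤ β ^ 2 := by nlinarith
  have hβ1 : 0 < β - 1 := by linarith
  refine mem_scaledIntegers_two hβ hroot (irrational_of_root hm hroot) hxy (hc.add hd) ?_ ?_
  · nlinarith
  · nlinarith [mul_le_mul_of_nonneg_right h4 (by positivity : 0 ≤ β * (β - 1))]

theorem two_mem_mulBounds (hm : 3 ≤ m) (hβ : 1 < β) (hroot : β ^ 2 = (m : ℝ) * β - 1) :
    2 ∈ mulBounds β := by
  intro x hx y hy hxy
  obtain ⟨c, hc, c1, c2⟩ := exists_isConj_of_mem_integers hβ hroot hx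
  obtain ⟨d, hd, d1, d2⟩ := exists_isConj_of_mem_integers hβ hroot hy
  have hβ1 : 0 < β - 1 := by linarith
  have hp : 0 < β + 1 := by linarith
  have hc' : |c * (β + 1)| ≤ β * (β - 1) := abs_le.2 ⟨by nlinarith, c2.le⟩
  have hd' : |d * (β + 1)| ≤ β * (β - 1) := abs_le.2 ⟨by nlinarith, d2.le⟩
  -- This is the smaller of the two thresholds in `mem_scaledIntegers_two`, times `β + 1`, so it
  -- serves for either sign.
  have habs : |c * d * (β + 1) * (β + 1)| ≤ β ^ 2 * (β - 1) * (β + 1) := by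
    calc |c * d * (β + 1) * (β + 1)| = |c * (β + 1)| * |d * (β + 1)| := by
          rw [← abs_mul]; ring_nf
      _ ≤ β * (β - 1) * (β * (β - 1)) :=
          mul_le_mul hc' hd' (abs_nonneg _) (by positivity)
      _ = β ^ 2 * (β - 1) * (β - 1) := by ring
      _ ≤ β ^ 2 * (β - 1) * (β + 1) :=
          mul_le_mul_of_nonneg_left (by linarith) (by positivity)
  rw [abs_mul, abs_of_pos hp] at habs
  obtain ⟨h1, h2⟩ := abs_le.1 (le_of_mul_le_mul_right habs hp)
  refine mem_scaledIntegers_two hβ hroot (irrational_of_root hm hroot) hxy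
    (hc.mul hroot hd) h1 (h2.trans ?_)
  exact mul_le_mul_of_nonneg_right (pow_le_pow_right₀ hβ.le (by norm_num)) hβ1.le

/-! ### Explicit expansions -/

/-- The number `0 • d z₁ z₂ ⋯` if `z = 0 • z₁ z₂ ⋯`. -/
noncomputable def cons (β : ℝ) (d : ℤ) (z : ℝ) : ℝ := -(d + z) / β

/-- The value `-1/(β(β+1))` is the image under `T` of the left endpoint, whence the condition on `z`
when `d = m-1`. The last conclusion supplies that condition for the next digit to the left: any
digit `≥ 1` may follow `m-1`. -/
theorem cons_spec (hβ : 1 < β) (hroot : β ^ 2 = (m : ℝ) * β - 1) {d : ℤ} {z : ℝ}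
    (hz : z ∈ domain β) (hd0 : 0 ≤ d)
    (hd : d ≤ m - 2 ∨ d = m - 1 ∧ z * (β * (β + 1)) < -1) :
    cons β d z ∈ domain β ∧ T β (cons β d z) = z ∧
      (1 ≤ d → cons β d z * (β * (β + 1)) < -1) := by
  have hb : -β * cons β d z = d + z := by
    unfold cons
    field_simp
  have hp : 0 < β + 1 := by linarith
  have hpp : 0 < β * (β + 1) := by positivity
  obtain ⟨z1, z2⟩ := (mem_domain_iff hβ).1 hz
  have hd0' : (0 : ℝ) ≤ d := by exact_mod_cast hd0
  refine ⟨?_, T_eq_of_bounds hβ d hb z1.le z2, fun h => ?_⟩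
  · have e : β * (cons β d z * (β + 1)) = -(d * (β + 1) + z * (β + 1)) := by
      linear_combination -(β + 1) * hb
    rw [mem_domain_iff hβ]
    constructor
    · refine lt_of_mul_lt_mul_left ?_ (by positivity : 0 ≤ β ^ 2)
      have e' : β ^ 2 * (cons β d z * (β + 1)) = -(d * (β * (β + 1)) + z * (β * (β + 1))) := by
        linear_combination β * e
      rw [e']
      suffices d * (β * (β + 1)) + z * (β * (β + 1)) < β ^ 3 by nlinarith
      rcases hd with hd | ⟨rfl, hz'⟩
      · have hd' : (d : ℝ) ≤ m - 2 := by exact_mod_cast hd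
        have := mul_le_mul_of_nonneg_right hd' hpp.le
        have em : ((m : ℝ) - 2) * (β * (β + 1)) = β ^ 3 - β ^ 2 - β + 1 := by
          linear_combination -(β + 1) * hroot
        nlinarith
      · have em : ((m : ℝ) - 1) * (β * (β + 1)) = β ^ 3 + 1 := by
          linear_combination -(β + 1) * hroot
        push_cast
        linarith
    · refine lt_of_mul_lt_mul_left ?_ (by linarith : 0 ≤ β)
      rw [e]
      nlinarith
  · have h' : (1 : ℝ) ≤ d := by exact_mod_cast h
    have e : cons β d z * (β * (β + 1)) = -(d * (β + 1) + z * (β + 1)) := by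
      linear_combination -(β + 1) * hb
    rw [e]
    nlinarith

theorem cons_one_zero_ne_zero (hβ : 1 < β) : cons β 1 0 ≠ 0 := by
  have : β ≠ 0 := by linarith
  simp [cons, this]

/-! ### Witnesses for the lower bounds -/

theorem two_le_of_mem_scaledIntegers (hβ : 1 < β) {n l : ℕ} {y : ℝ} (hy : y ∈ domain β)
    (hne : (T β)^[n + 1] y ≠ 0) (h : (-β) ^ n * y ∈ scaledIntegers β l) : 2 ≤ l := by
  rw [pow_mul_mem_scaledIntegers_iff hβ n l hy] at h
  by_contra hl
  exact hne (iterate_T_eq_zero_of_le hβ (by omega) h)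

theorem intCast_mem_integers (hβ : 1 < β) (hroot : β ^ 2 = (m : ℝ) * β - 1) {d : ℤ}
    (hd0 : 0 ≤ d) (hd : d ≤ m - 2) : (d : ℝ) ∈ integers β := by
  obtain ⟨h1, h2, -⟩ := cons_spec hβ hroot (zero_mem_domain hβ) hd0 (.inl hd)
  have : (d : ℝ) = (-β) ^ 1 * cons β d 0 := by
    unfold cons
    field_simp
    ring
  rw [this, pow_mul_mem_integers_iff hβ 1 h1]
  exact h2

theorem sq_add_intCast_mem_integers (hm : 3 ≤ m) (hβ : 1 < β)
    (hroot : β ^ 2 = (m : ℝ) * β - 1) {d : ℤ} (hd0 : 0 ≤ d) (hd : d ≤ m - 2) :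
    β ^ 2 + d ∈ integers β := by
  obtain ⟨a1, a2, -⟩ := cons_spec hβ hroot (zero_mem_domain hβ) hd0 (.inl hd)
  obtain ⟨b1, b2, -⟩ := cons_spec (d := 0) hβ hroot a1 le_rfl (.inl (by omega))
  obtain ⟨c1, c2, -⟩ := cons_spec (d := 1) hβ hroot b1 (by norm_num) (.inl (by omega))
  have : β ^ 2 + d = (-β) ^ 3 * cons β 1 (cons β 0 (cons β d 0)) := by
    unfold cons
    push_cast
    field_simp
    ring
  rw [this, pow_mul_mem_integers_iff hβ 3 c1]
  simp [c2, b2, a2]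

theorem two_le_of_mem_addBounds (hm : 3 ≤ m) (hβ : 1 < β) (hroot : β ^ 2 = (m : ℝ) * β - 1)
    {l : ℕ} (hl : l ∈ addBounds β) : 2 ≤ l := by
  obtain ⟨a1, a2, a3⟩ := cons_spec (d := 1) hβ hroot (zero_mem_domain hβ) (by norm_num)
    (.inl (by omega))
  obtain ⟨b1, b2, -⟩ := cons_spec (d := m - 1) hβ hroot a1 (by omega)
    (.inr ⟨rfl, a3 le_rfl⟩)
  obtain ⟨c1, c2, c3⟩ := cons_spec (d := 1) hβ hroot b1 (by norm_num) (.inl (by omega))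
  obtain ⟨d1, d2, -⟩ := cons_spec (d := m - 1) hβ hroot c1 (by omega)
    (.inr ⟨rfl, c3 le_rfl⟩)
  obtain ⟨e1, e2, -⟩ := cons_spec (d := 1) hβ hroot d1 (by norm_num) (.inl (by omega))
  -- The expansion of `m - 1` is `1 (m-1) 1 • (m-1) 1`.
  set y := cons β 1 (cons β (m - 1) (cons β 1 (cons β (m - 1) (cons β 1 0)))) with hy
  have hT : (T β)^[3 + 1] y = cons β 1 0 := by simp [e2, d2, c2, b2]
  have hs : (((m : ℤ) - 2 : ℤ) : ℝ) + ((1 : ℤ) : ℝ) = (-β) ^ 3 * y := by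
    have h0 : β ≠ 0 := by linarith
    rw [hy]
    unfold cons
    push_cast
    field_simp
    linear_combination -(β ^ 2 + β + 1) * hroot
  refine two_le_of_mem_scaledIntegers (n := 3) hβ e1
    (by rw [hT]; exact cons_one_zero_ne_zero hβ) ?_
  rw [← hs]
  refine hl _ (intCast_mem_integers hβ hroot (by omega) le_rfl) _
    (intCast_mem_integers hβ hroot (by norm_num) (by omega)) ?_
  rw [hs, pow_mul_mem_finSet_iff hβ 3 e1]
  exact ⟨5, by rw [Function.iterate_succ_apply', hT, a2]⟩

theorem two_le_of_mem_mulBounds (hm : 3 ≤ m) (hβ : 1 < β) (hroot : β ^ 2 = (m : ℝ) * β - 1)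
    {l : ℕ} (hl : l ∈ mulBounds β) : 2 ≤ l := by
  obtain ⟨a1, a2, a3⟩ := cons_spec (d := 1) hβ hroot (zero_mem_domain hβ) (by norm_num)
    (.inl (by omega))
  obtain ⟨b1, b2, -⟩ := cons_spec (d := m - 1) hβ hroot a1 (by omega)
    (.inr ⟨rfl, a3 le_rfl⟩)
  obtain ⟨c1, c2, -⟩ := cons_spec (d := 0) hβ hroot b1 le_rfl (.inl (by omega))
  obtain ⟨d1, d2, -⟩ := cons_spec (d := m - 2) hβ hroot c1 (by omega) (.inl le_rfl)
  obtain ⟨e1, e2, e3⟩ := cons_spec (d := 1) hβ hroot d1 (by norm_num) (.inl (by omega))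
  obtain ⟨f1, f2, f3⟩ := cons_spec (d := m - 1) hβ hroot e1 (by omega)
    (.inr ⟨rfl, e3 le_rfl⟩)
  -- For `m = 3` the leading digit 2 equals `m - 1` and needs the condition on what follows.
  obtain ⟨g1, g2, -⟩ := cons_spec (d := 2) hβ hroot f1 (by norm_num) (by
    have := f3 (by omega)
    rcases hm.eq_or_lt with rfl | h
    · exact .inr ⟨by norm_num, this⟩
    · exact .inl (by omega))
  -- The product `(β²+m-2)(β²+1)` has expansion `2 (m-1) 1 (m-2) 0 • (m-1) 1`.
  set y := cons β 2 (cons β (m - 1) (cons β 1 (cons β (m - 2) (cons β 0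
    (cons β (m - 1) (cons β 1 0)))))) with hy
  have hT : (T β)^[5 + 1] y = cons β 1 0 := by simp [g2, f2, e2, d2, c2, b2]
  have hs : (β ^ 2 + (((m : ℤ) - 2 : ℤ) : ℝ)) * (β ^ 2 + ((1 : ℤ) : ℝ)) = (-β) ^ 5 * y := by
    have h0 : β ≠ 0 := by linarith
    rw [hy]
    unfold cons
    push_cast
    field_simp
    linear_combination -(β ^ 4 + β ^ 3 + β ^ 2 + β + 1) * hroot
  refine two_le_of_mem_scaledIntegers (n := 5) hβ g1
    (by rw [hT]; exact cons_one_zero_ne_zero hβ) ?_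
  rw [← hs]
  refine hl _ (sq_add_intCast_mem_integers hm hβ hroot (by omega) le_rfl) _
    (sq_add_intCast_mem_integers hm hβ hroot (by norm_num) (by omega)) ?_
  rw [hs, pow_mul_mem_finSet_iff hβ 5 g1]
  exact ⟨7, by rw [Function.iterate_succ_apply', hT, a2]⟩

end NegBeta

theorem mainTheorem2 (m : ℕ) (hm : 3 ≤ m) (β : ℝ) (hβ : 1 < β)
    (hroot : β ^ 2 = (m : ℝ) * β - 1) :
    NegBeta.IsLAdd β 2 ∧ NegBeta.IsLMul β 2 :=
  ⟨⟨NegBeta.two_mem_addBounds hm hβ hroot,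
      fun _ hl => NegBeta.two_le_of_mem_addBounds hm hβ hroot hl⟩,
    ⟨NegBeta.two_mem_mulBounds hm hβ hroot,
      fun _ hl => NegBeta.two_le_of_mem_mulBounds hm hβ hroot hl⟩⟩
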